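/- Let $n\ge 1$, let $x_1<x_2<\cdots<x_n$ be real numbers and let $m_1,\dots,m_n>0$. For $z\in\mathbf C$ let $\varphi(x)=\varphi(x;z)$ be the unique solution on $\mathbf R$ of the discrete cubic string equation $-\varphi'''=z\,\mu\,\varphi$, $\mu=2\sum_{k=1}^n m_k\delta_{x_k}$, with $\varphi=1$ for $x<x_1$; that is, $\varphi$ and $\varphi_x$ are continuous, $\varphi_{xxx}=0$ away from the points $x_k$, and $\varphi_{xx}$ jumps by $-2z\,m_k\,\varphi(x_k)$ at $x_k$. Put $A(z)=\varphi_{xx}(x_n+;z)$, $B(z)=\varphi_x(x_n+;z)$ and let $W(z)=B(z)/A(z)$ be the Weyl function. Then the zeros of $A$ in $\mathbf C$ are exactly $0$ and $n-1$ further real numbers $0<\lambda_1<\cdots<\lambda_{n-1}$, the Weyl function has the partial fraction decomposition $$W(z)=\sum_{k=1}^{n-1}\frac{b_k}{z-\lambda_k}\qquad (A(z)\neq 0),$$ and all the residues $b_1,\dots,b_{n-1}$ are real and negative. Consequently the zeros of $\varphi_x(x_n+;z)$ and $\varphi_{xx}(x_n+;z)$, as functions of $z$, interlace: if $n\ge 2$,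 then the zeros of $B$ in $\mathbf C$ are exactly $0$ (a common zero with $A$) and $n-2$ real numbers $\mu_1,\dots,\mu_{n-2}$ with $$\lambda_1<\mu_1<\lambda_2<\mu_2<\cdots<\mu_{n-2}<\lambda_{n-1}.$$ -/

import Mathlib

/-- `IsWaveFunction x m z φ`: the function `φ` solves the cubic string equation `-φ''' = z μ φ` on the
real line for the discrete measure `μ = 2 ∑ₖ mₖ δ_{xₖ}`, normalised by `φ = 1` to the left of all the
point masses. Since `φ'''` is a combination of Dirac deltas, the equation says that `φ` and `φ'`
are continuous, that `φ''' = 0` away from the points `xₖ`, and that `φ''` jumps by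
`-2 z mₖ φ(xₖ)` at `xₖ`. -/
structure IsWaveFunction {N : ℕ} (x m : Fin (N + 1) → ℝ) (z : ℂ) (φ : ℝ → ℂ) : Prop where
  eq_one_left : ∀ y < x 0, φ y = 1
  contDiff_one : ContDiff ℝ 1 φ
  contDiffAt_three : ∀ y ∉ Set.range x, ContDiffAt ℝ 3 φ y
  iteratedDeriv_three : ∀ y ∉ Set.range x, iteratedDeriv 3 φ y = 0
  jump : ∀ k, ∃ a b : ℂ,
    Filter.Tendsto (iteratedDeriv 2 φ) (nhdsWithin (x k) (Set.Iio (x k))) (nhds a) ∧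
    Filter.Tendsto (iteratedDeriv 2 φ) (nhdsWithin (x k) (Set.Ioi (x k))) (nhds b) ∧
    b - a = -2 * z * (m k : ℂ) * φ (x k)

/-- Auxiliary coefficients for the explicit construction of the wave function. -/
noncomputable def waveCoeff {N : ℕ} (x m : Fin (N + 1) → ℝ) (z : ℂ) (k : Fin (N + 1)) : ℂ :=
  -z * (m k : ℂ) * (1 + ∑ j : {j : Fin (N + 1) // j < k},
    waveCoeff x m z j.1 * (((x k - x j.1) ^ 2 : ℝ) : ℂ))
termination_by k
decreasing_by exact j.2

theorem hasDerivAt_truncSq (a y : ℝ) :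
    HasDerivAt (fun y : ℝ => ((max (y - a) 0 ^ 2 : ℝ) : ℂ)) ((2 * max (y - a) 0 : ℝ) : ℂ) y := by
  refine HasDerivAt.ofReal_comp ?_
  rcases lt_trichotomy y a with h | h | h
  · have e : (fun y : ℝ => max (y - a) 0 ^ 2) =ᶠ[nhds y] fun _ => 0 := by
      filter_upwards [Iio_mem_nhds h] with t ht
      rw [max_eq_right (by have := Set.mem_Iio.1 ht; linarith)]; norm_num
    rw [max_eq_right (by linarith)]
    simpa using (hasDerivAt_const y (0 : ℝ)).congr_of_eventuallyEq e
  · subst h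
    rw [hasDerivAt_iff_isLittleO]
    simp only [sub_self, max_self, mul_zero, smul_zero, sub_zero]
    have : (fun t : ℝ => max (t - y) 0 ^ 2 - (0 : ℝ) ^ 2) =O[nhds y] fun t => (t - y) ^ 2 := by
      refine Asymptotics.isBigO_of_le _ fun t => ?_
      rw [Real.norm_eq_abs, Real.norm_eq_abs]
      rcases le_total (t - y) 0 with h | h
      · rw [max_eq_right h]; simpa using sq_nonneg (t - y)
      · rw [max_eq_left h]; simp
    refine this.trans_isLittleO ?_
    have h2 : (fun t : ℝ => t - y) =o[nhds y] fun _ => (1 : ℝ) := by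
      rw [Asymptotics.isLittleO_one_iff]
      have : Filter.Tendsto (fun t : ℝ => t - y) (nhds y) (nhds (y - y)) :=
        (continuous_id.sub continuous_const).tendsto y
      simpa using this
    simpa [sq] using h2.mul_isBigO (Asymptotics.isBigO_refl (fun t : ℝ => t - y) (nhds y))
  · have e : (fun y : ℝ => max (y - a) 0 ^ 2) =ᶠ[nhds y] fun t => (t - a) ^ 2 := by
      filter_upwards [Ioi_mem_nhds h] with t ht
      rw [max_eq_left (by have := Set.mem_Ioi.1 ht; linarith)]
    rw [max_eq_left (by linarith)]
    refine HasDerivAt.congr_of_eventuallyEq ?_ e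
    have := ((hasDerivAt_id' y).sub_const a).fun_pow 2
    norm_num at this
    exact this

theorem hasDerivAt_trunc {a y : ℝ} (h : y ≠ a) :
    HasDerivAt (fun y : ℝ => ((2 * max (y - a) 0 : ℝ) : ℂ)) (if a < y then 2 else 0) y := by
  rcases lt_or_gt_of_ne h with h | h
  · have e : (fun y : ℝ => ((2 * max (y - a) 0 : ℝ) : ℂ)) =ᶠ[nhds y] fun _ => 0 := by
      filter_upwards [Iio_mem_nhds h] with t ht
      rw [max_eq_right (by have := Set.mem_Iio.1 ht; linarith)]; norm_num
    rw [if_neg (by linarith)]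
    exact (hasDerivAt_const y (0 : ℂ)).congr_of_eventuallyEq e
  · have e : (fun y : ℝ => ((2 * max (y - a) 0 : ℝ) : ℂ)) =ᶠ[nhds y]
        fun t => ((2 * (t - a) : ℝ) : ℂ) := by
      filter_upwards [Ioi_mem_nhds h] with t ht
      rw [max_eq_left (by have := Set.mem_Ioi.1 ht; linarith)]
    rw [if_pos h]
    refine HasDerivAt.congr_of_eventuallyEq ?_ e
    have := (((hasDerivAt_id y).sub_const a).const_mul 2).ofReal_comp
    simpa using this

/-- The wave function exists. -/
theorem exists_isWaveFunction {N : ℕ} {x : Fin (N + 1) → ℝ} (hx : StrictMono x)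
    (m : Fin (N + 1) → ℝ) (z : ℂ) : ∃ φ, IsWaveFunction x m z φ := by
  set c := waveCoeff x m z with hc
  set φ : ℝ → ℂ := fun y => 1 + ∑ k, c k * ((max (y - x k) 0 ^ 2 : ℝ) : ℂ) with hφ
  have d1 : ∀ y, HasDerivAt φ (∑ k, c k * ((2 * max (y - x k) 0 : ℝ) : ℂ)) y := fun y =>
    (HasDerivAt.fun_sum fun k _ => (hasDerivAt_truncSq (x k) y).const_mul (c k)).const_add 1
  have e1 : deriv φ = fun y => ∑ k, c k * ((2 * max (y - x k) 0 : ℝ) : ℂ) :=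
    funext fun y => (d1 y).deriv
  have e2 : ∀ y ∉ Set.range x, iteratedDeriv 2 φ y = ∑ k, c k * (if x k < y then 2 else 0) := by
    intro y hy
    rw [iteratedDeriv_succ, iteratedDeriv_one, e1]
    exact (HasDerivAt.fun_sum fun k _ =>
      (hasDerivAt_trunc (a := x k) (fun h => hy ⟨k, h.symm⟩)).const_mul (c k)).deriv
  have hopen : IsOpen (Set.range x)ᶜ := (Set.finite_range x).isClosed.isOpen_compl
  have hval : ∀ k, φ (x k) = 1 + ∑ j : {j : Fin (N + 1) // j < k},
      c j.1 * (((x k - x j.1) ^ 2 : ℝ) : ℂ) := by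
    intro k
    simp only [hφ]
    congr 1
    rw [← Finset.sum_filter_add_sum_filter_not Finset.univ (· < k)]
    have h0 : ∑ j ∈ Finset.univ.filter (fun j => ¬ j < k),
        c j * ((max (x k - x j) 0 ^ 2 : ℝ) : ℂ) = 0 := by
      refine Finset.sum_eq_zero fun j hj => ?_
      have : x k ≤ x j := hx.monotone (not_lt.1 (Finset.mem_filter.1 hj).2)
      rw [max_eq_right (by linarith)]; simp
    rw [h0, add_zero, Finset.sum_subtype (p := (· < k)) _ (by simp)]
    refine Finset.sum_congr rfl fun j _ => ?_
    have : x j.1 < x k := hx j.2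
    rw [max_eq_left (by linarith)]
  have hck : ∀ k, c k = -z * (m k : ℂ) * φ (x k) := by
    intro k
    rw [hval, hc, waveCoeff]
  have hside : ∀ k t, (∀ j, x j < t ↔ x j < x k ∨ j = k) → t ∉ Set.range x →
      iteratedDeriv 2 φ t = ∑ j, c j * (if x j < x k ∨ j = k then 2 else 0) := by
    intro k t h ht
    rw [e2 t ht]
    simp only [h]
  refine ⟨φ, fun y hy => ?_, ?_, fun y hy => ?_, fun y hy => ?_, fun k => ?_⟩
  · have : ∀ k, c k * ((max (y - x k) 0 ^ 2 : ℝ) : ℂ) = 0 := fun k => by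
      have : x 0 ≤ x k := hx.monotone (Fin.zero_le k)
      rw [max_eq_right (by linarith)]; simp
    simp only [hφ, this, Finset.sum_const_zero, add_zero]
  · rw [contDiff_one_iff_deriv]
    refine ⟨fun y => (d1 y).differentiableAt, ?_⟩
    rw [e1]
    fun_prop
  · refine contDiffAt_const.add (ContDiffAt.sum fun k _ => contDiffAt_const.mul ?_)
    rcases lt_or_gt_of_ne (fun h => hy ⟨k, h.symm⟩ : y ≠ x k) with h | h
    · refine (contDiffAt_const (c := (0 : ℂ))).congr_of_eventuallyEq ?_
      filter_upwards [Iio_mem_nhds h] with t ht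
      rw [max_eq_right (by have := Set.mem_Iio.1 ht; linarith)]; norm_num
    · have : ContDiffAt ℝ 3 (fun t : ℝ => (((t - x k) ^ 2 : ℝ) : ℂ)) y :=
        Complex.ofRealCLM.contDiff.contDiffAt.comp y
          ((contDiffAt_id.sub contDiffAt_const).pow 2)
      refine this.congr_of_eventuallyEq ?_
      filter_upwards [Ioi_mem_nhds h] with t ht
      rw [max_eq_left (by have := Set.mem_Ioi.1 ht; linarith)]
  · rw [iteratedDeriv_succ]
    have e : iteratedDeriv 2 φ =ᶠ[nhds y] fun _ => ∑ k, c k * (if x k < y then 2 else 0) := by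
      have h : ∀ᶠ t in nhds y, ∀ k, (x k < t ↔ x k < y) := by
        refine Filter.eventually_all.2 fun k => ?_
        rcases lt_or_gt_of_ne (fun h => hy ⟨k, h.symm⟩ : y ≠ x k) with h | h
        · filter_upwards [Iio_mem_nhds h] with t ht
          exact iff_of_false (not_lt.2 (le_of_lt ht)) (not_lt.2 h.le)
        · filter_upwards [Ioi_mem_nhds h] with t ht
          exact iff_of_true ht h
      filter_upwards [h, hopen.mem_nhds hy] with t ht ht'
      rw [e2 t ht']
      simp only [ht]
    rw [e.deriv_eq, deriv_const]
  · refine ⟨∑ j, c j * (if x j < x k then 2 else 0),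
      ∑ j, c j * (if x j < x k ∨ j = k then 2 else 0), ?_, ?_, ?_⟩
    · refine tendsto_const_nhds.congr' ?_
      have h : ∀ᶠ t in nhdsWithin (x k) (Set.Iio (x k)), ∀ j, (x j < t ↔ x j < x k) ∧ t ≠ x j := by
        refine Filter.eventually_all.2 fun j => ?_
        rcases lt_or_ge (x j) (x k) with h | h
        · filter_upwards [mem_nhdsWithin_of_mem_nhds (Ioi_mem_nhds h)] with t ht
          exact ⟨iff_of_true ht h, ne_of_gt ht⟩
        · filter_upwards [self_mem_nhdsWithin] with t ht
          have := Set.mem_Iio.1 ht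
          exact ⟨iff_of_false (by linarith) (by linarith), by linarith⟩
      filter_upwards [h] with t ht
      rw [e2 t (by rintro ⟨j, rfl⟩; exact (ht j).2 rfl)]
      simp only [fun j => (ht j).1]
    · refine tendsto_const_nhds.congr' ?_
      have h : ∀ᶠ t in nhdsWithin (x k) (Set.Ioi (x k)),
          ∀ j, (x j < t ↔ x j < x k ∨ j = k) ∧ t ≠ x j := by
        refine Filter.eventually_all.2 fun j => ?_
        rcases lt_or_ge k j with h | h
        · have h' := hx h
          filter_upwards [mem_nhdsWithin_of_mem_nhds (Iio_mem_nhds h')] with t ht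
          have := Set.mem_Iio.1 ht
          refine ⟨iff_of_false (by linarith) ?_, by linarith⟩
          rintro (h1 | h1)
          · linarith
          · exact h.ne' h1
        · have h' := hx.monotone h
          filter_upwards [self_mem_nhdsWithin] with t ht
          have := Set.mem_Ioi.1 ht
          refine ⟨iff_of_true (by linarith) ?_, by linarith⟩
          rcases h.lt_or_eq with h1 | h1
          · exact Or.inl (hx h1)
          · exact Or.inr h1
      filter_upwards [h] with t ht
      exact (hside k t (fun j => (ht j).1) (by rintro ⟨j, rfl⟩; exact (ht j).2 rfl)).symm
    · rw [← Finset.sum_sub_distrib, Finset.sum_eq_single k]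
      · simp [hck]; ring
      · intro j _ hj
        simp [hj]
      · simp

theorem differentiableAt_iteratedDeriv_aux {d : ℝ → ℂ} {s : ℝ} (h : ContDiffAt ℝ 3 d s) (n : ℕ)
    (hn : (n : WithTop ℕ∞) < 3) : DifferentiableAt ℝ (iteratedDeriv n d) s := by
  rw [← differentiableWithinAt_univ, ← iteratedDerivWithin_univ]
  exact h.contDiffWithinAt.differentiableWithinAt_iteratedDerivWithin hn
    (by simp [uniqueDiffOn_univ])

theorem eq_zero_of_deriv_two_tendsto {d : ℝ → ℂ} {a y : ℝ} (hd : ContDiff ℝ 1 d)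
    (h0 : ∀ t < a, d t = 0) (h3 : ∀ t ∈ Set.Ioo a y, ContDiffAt ℝ 3 d t)
    (h4 : ∀ t ∈ Set.Ioo a y, iteratedDeriv 3 d t = 0)
    (hl : Filter.Tendsto (iteratedDeriv 2 d) (nhdsWithin a (Set.Ioi a)) (nhds 0)) :
    ∀ t ∈ Set.Ioo a y, d t = 0 := by
  intro t ht
  have hay : a < y := ht.1.trans ht.2
  have key : ∀ f : ℝ → ℂ, (∀ s ∈ Set.Ioo a y, HasDerivAt f 0 s) →
      Filter.Tendsto f (nhdsWithin a (Set.Ioi a)) (nhds 0) → ∀ s ∈ Set.Ioo a y, f s = 0 := by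
    intro f hf hlim s hs
    have hconst : ∀ r ∈ Set.Ioo a y, f r = f s := fun r hr =>
      isOpen_Ioo.is_const_of_deriv_eq_zero (convex_Ioo a y).isPreconnected
        (fun w hw => (hf w hw).differentiableAt.differentiableWithinAt)
        (fun w hw => (hf w hw).deriv) hr hs
    refine tendsto_nhds_unique ?_ hlim
    refine tendsto_const_nhds.congr' ?_
    filter_upwards [Ioo_mem_nhdsGT hay] with r hr
    exact (hconst r hr).symm
  have hd2 : ∀ s ∈ Set.Ioo a y, iteratedDeriv 2 d s = 0 := by
    refine key _ (fun s hs => ?_) hl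
    have hdiff : DifferentiableAt ℝ (iteratedDeriv 2 d) s :=
      differentiableAt_iteratedDeriv_aux (h3 s hs) 2 (by norm_num)
    have := hdiff.hasDerivAt
    rwa [← iteratedDeriv_succ, h4 s hs] at this
  have hd1a : deriv d a = 0 := by
    have hc := (hd.continuous_deriv le_rfl).continuousWithinAt (s := Set.Iio a) (x := a)
    refine tendsto_nhds_unique hc ?_
    refine tendsto_const_nhds.congr' ?_
    filter_upwards [self_mem_nhdsWithin] with r hr
    have : d =ᶠ[nhds r] fun _ => 0 := by
      filter_upwards [Iio_mem_nhds hr] with w hw using h0 w hw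
    rw [this.deriv_eq, deriv_const]
  have hda : d a = 0 := by
    have hc := hd.continuous.continuousWithinAt (s := Set.Iio a) (x := a)
    refine tendsto_nhds_unique hc ?_
    refine tendsto_const_nhds.congr' ?_
    filter_upwards [self_mem_nhdsWithin] with r hr using (h0 r hr).symm
  have hd1 : ∀ s ∈ Set.Ioo a y, deriv d s = 0 := by
    refine key _ (fun s hs => ?_) ?_
    · have hdiff : DifferentiableAt ℝ (iteratedDeriv 1 d) s :=
        differentiableAt_iteratedDeriv_aux (h3 s hs) 1 (by norm_num)
      have := hdiff.hasDerivAt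
      rwa [← iteratedDeriv_succ, hd2 s hs, iteratedDeriv_one] at this
    · have hc := (hd.continuous_deriv le_rfl).continuousWithinAt (s := Set.Ioi a) (x := a)
      rwa [ContinuousWithinAt, hd1a] at hc
  refine key _ (fun s hs => ?_) ?_ t ht
  · have := (hd.differentiable one_ne_zero s).hasDerivAt
    rwa [hd1 s hs] at this
  · have hc := hd.continuous.continuousWithinAt (s := Set.Ioi a) (x := a)
    rwa [ContinuousWithinAt, hda] at hc

/-- The wave function is unique. -/
theorem IsWaveFunction.unique {N : ℕ} {x m : Fin (N + 1) → ℝ} {z : ℂ} {φ ψ : ℝ → ℂ}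
    (hx : StrictMono x) (hφ : IsWaveFunction x m z φ) (hψ : IsWaveFunction x m z ψ) : φ = ψ := by
  have hd : ContDiff ℝ 1 (φ - ψ) := hφ.contDiff_one.sub hψ.contDiff_one
  have hdn : ∀ n : ℕ, n ≤ 3 → ∀ t ∉ Set.range x,
      iteratedDeriv n (φ - ψ) t = iteratedDeriv n φ t - iteratedDeriv n ψ t := by
    intro n hn t ht
    have hn' : (n : WithTop ℕ∞) ≤ 3 := by exact_mod_cast hn
    exact iteratedDeriv_sub ((hφ.contDiffAt_three t ht).of_le hn')
      ((hψ.contDiffAt_three t ht).of_le hn')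
  have hclosed : ∀ k : Fin (N + 1), ∀ᶠ t in nhdsWithin (x k) (Set.Ioi (x k)), t ∉ Set.range x := by
    intro k
    have h : ∀ᶠ t in nhdsWithin (x k) (Set.Ioi (x k)), ∀ j, t ≠ x j := by
      refine Filter.eventually_all.2 fun j => ?_
      rcases lt_or_ge (x k) (x j) with h | h
      · filter_upwards [mem_nhdsWithin_of_mem_nhds (Iio_mem_nhds h)] with t ht
        exact ne_of_lt ht
      · filter_upwards [self_mem_nhdsWithin] with t ht
        exact ne_of_gt (lt_of_le_of_lt h ht)
    filter_upwards [h] with t ht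
    rintro ⟨j, rfl⟩
    exact ht j rfl
  have step : ∀ (k : Fin (N + 1)) (y : ℝ), (∀ t < x k, (φ - ψ) t = 0) →
      (∀ t ∈ Set.Ioo (x k) y, t ∉ Set.range x) → ∀ t < y, (φ - ψ) t = 0 := by
    intro k y h0 hy t hty
    have heq : (φ - ψ) (x k) = 0 := by
      have hc := hd.continuous.continuousWithinAt (s := Set.Iio (x k)) (x := x k)
      refine tendsto_nhds_unique hc ?_
      refine tendsto_const_nhds.congr' ?_
      filter_upwards [self_mem_nhdsWithin] with r hr using (h0 r hr).symm
    rcases lt_trichotomy t (x k) with h | h | h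
    · exact h0 t h
    · rw [h]; exact heq
    refine eq_zero_of_deriv_two_tendsto hd h0
      (fun s hs => (hφ.contDiffAt_three s (hy s hs)).sub (hψ.contDiffAt_three s (hy s hs)))
      (fun s hs => by
        rw [hdn 3 le_rfl s (hy s hs), hφ.iteratedDeriv_three s (hy s hs),
          hψ.iteratedDeriv_three s (hy s hs), sub_zero]) ?_ t ⟨h, hty⟩
    obtain ⟨a, b, ha, hb, hab⟩ := hφ.jump k
    obtain ⟨a', b', ha', hb', hab'⟩ := hψ.jump k
    have haa : a = a' := by
      refine tendsto_nhds_unique ha (ha'.congr' ?_)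
      filter_upwards [self_mem_nhdsWithin] with r hr
      have : ψ =ᶠ[nhds r] φ := by
        filter_upwards [Iio_mem_nhds hr] with w hw using (sub_eq_zero.1 (h0 w hw)).symm
      exact this.iteratedDeriv_eq 2
    have hbb : b - b' = 0 := by
      have h1 : φ (x k) = ψ (x k) := sub_eq_zero.1 heq
      rw [h1, ← hab', haa] at hab
      linear_combination hab
    rw [← hbb]
    refine (hb.sub hb').congr' ?_
    filter_upwards [hclosed k] with r hr
    exact (hdn 2 (by norm_num) r hr).symm
  have all : ∀ k (hk : k < N + 1), ∀ t < x ⟨k, hk⟩, (φ - ψ) t = 0 := by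
    intro k
    induction k with
    | zero =>
      intro hk t ht
      change t < x 0 at ht
      rw [Pi.sub_apply, hφ.eq_one_left t ht, hψ.eq_one_left t ht, sub_self]
    | succ k ih =>
      intro hk
      refine step ⟨k, by omega⟩ _ (ih (by omega)) ?_
      rintro t ⟨h1, h2⟩ ⟨j, rfl⟩
      have h1' := hx.lt_iff_lt.1 h1
      have h2' := hx.lt_iff_lt.1 h2
      rw [Fin.lt_def] at h1' h2'
      simp only at h1' h2'
      omega
  funext t
  refine sub_eq_zero.1 (step (Fin.last N) (t + 1) (all N (by omega)) ?_ t (by linarith))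
  rintro s ⟨h1, -⟩ ⟨j, rfl⟩
  exact absurd (hx.lt_iff_lt.1 h1) (not_lt.2 (Fin.le_last j))

/-- The wave function `φ(·; z)` of the discrete cubic string with point masses `2 mₖ` at the points
`x₀ < ⋯ < x_N`: the solution of `-φ''' = z μ φ` with `φ = 1` to the left of the masses. -/
noncomputable def waveFunction {N : ℕ} (x m : Fin (N + 1) → ℝ) (hx : StrictMono x) (z : ℂ) :
    ℝ → ℂ :=
  (exists_isWaveFunction hx m z).choose

theorem isWaveFunction_waveFunction {N : ℕ} (x m : Fin (N + 1) → ℝ) (hx : StrictMono x) (z : ℂ) :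
    IsWaveFunction x m z (waveFunction x m hx z) :=
  (exists_isWaveFunction hx m z).choose_spec

/-- `A(z) = φ_xx(x_N +; z)`, the second derivative immediately to the right of the last mass.
The spectrum of the string is the zero set of `A`. -/
noncomputable def stringA {N : ℕ} (x m : Fin (N + 1) → ℝ) (hx : StrictMono x) (z : ℂ) : ℂ :=
  Function.rightLim (iteratedDeriv 2 (waveFunction x m hx z)) (x (Fin.last N))

/-- `B(z) = φ_x(x_N +; z)`, the first derivative immediately to the right of the last mass. -/
noncomputable def stringB {N : ℕ} (x m : Fin (N + 1) → ℝ) (hx : StrictMono x) (z : ℂ) : ℂ :=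
  Function.rightLim (deriv (waveFunction x m hx z)) (x (Fin.last N))

/-- The Weyl function `W = B / A`, meaningful where `A z ≠ 0`. -/
noncomputable def weylW {N : ℕ} (x m : Fin (N + 1) → ℝ) (hx : StrictMono x) (z : ℂ) : ℂ :=
  stringB x m hx z / stringA x m hx z

/-! In the spectral parameter `z`, the values of `φ`, `φ_x`, `φ_xx` at the masses are real
polynomials, produced by alternating two moves, `gap` (Taylor expansion across an interval) and
`kick` (the jump at a mass). For `z` in the upper half-plane consider `w(f,g) = Im (f conj g)` and
`h(f,g) = Im (z f conj g)`. Nonnegativity of both on the ordered pairs from (`val`, `slope`, `curv`)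
survives both moves (`Interlaced.gap`, `Interlaced.kick`), and `w(val, curv)` becomes and stays
strictly positive (`w_val_curv_waveState_pos`). Hence `A` has no nonreal zeros.

The argument uses only the axioms of `InterlacingForm`, so it also applies to the limit of the forms
at a real point, where `w` is a Wronskian: the zeros of `A` are simple. Degree, positivity on the
negative axis and the zero at `0` then locate them.

At real `y ≠ 0` the Wronskian `B'A - BA'` is strictly positive from the second mass on
(`wronskian_slope_curv_pos`). At a zero of `A` this reads `BA' < 0`, so the residues `B/A'` are
negative. By Rolle, `B` vanishes between consecutive positive zeros of `A`, and its degree leaves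
room for no more. -/

open Polynomial

/-! ### Transfer of polynomial states along the string -/

/-- The wave function, its first and its second derivative at a point, as polynomials in the
spectral parameter. -/
structure WaveState where
  val : ℝ[X]
  slope : ℝ[X]
  curv : ℝ[X]

/-- Propagation of a wave state over a mass-free interval of length `l`. -/
noncomputable def WaveState.gap (s : WaveState) (l : ℝ) : WaveState where
  val := s.val + l • s.slope + (l ^ 2 / 2) • s.curv
  slope := s.slope + l • s.curv
  curv := s.curv

/-- Propagation of a wave state across a point mass `2 m`. -/
noncomputable def WaveState.kick (s : WaveState) (m : ℝ) : WaveState where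
  val := s.val
  slope := s.slope
  curv := s.curv - (2 * m) • (X * s.val)

/-- The state of the wave function immediately to the right of the `k`-th mass. -/
noncomputable def waveState (x m : ℕ → ℝ) : ℕ → WaveState
  | 0 => WaveState.kick ⟨1, 0, 0⟩ (m 0)
  | k + 1 => ((waveState x m k).gap (x (k + 1) - x k)).kick (m (k + 1))

/-! ### Interlacing forms and their invariance under the two moves -/

/-- A pair of bilinear forms on real polynomials modelled on `Im (f(z) conj g(z))` and
`Im (z f(z) conj g(z))` for `z` in the upper half-plane. -/
structure InterlacingForm where
  w : ℝ[X] →ₗ[ℝ] ℝ[X] →ₗ[ℝ] ℝ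
  h : ℝ[X] →ₗ[ℝ] ℝ[X] →ₗ[ℝ] ℝ
  nu : ℝ
  nu_nonneg : 0 ≤ nu
  w_swap : ∀ f g, w f g = -w g f
  h_nonneg : ∀ f, 0 ≤ h f f
  h_one : 0 < h 1 1
  w_X : ∀ f g, w f (X * g) = -h g f
  h_X : ∀ f g, h f (X * g) = nu * w f g

theorem InterlacingForm.w_self (F : InterlacingForm) (f : ℝ[X]) : F.w f f = 0 := by
  linarith [F.w_swap f f]

/-- The three components of a wave state interlace in the order `val`, `slope`, `curv`. -/
structure WaveState.Interlaced (F : InterlacingForm) (s : WaveState) : Prop where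
  w_val_slope : 0 ≤ F.w s.val s.slope
  w_slope_curv : 0 ≤ F.w s.slope s.curv
  w_val_curv : 0 ≤ F.w s.val s.curv
  h_val_slope : 0 ≤ F.h s.val s.slope
  h_slope_curv : 0 ≤ F.h s.slope s.curv
  h_val_curv : 0 ≤ F.h s.val s.curv

namespace WaveState

variable {F : InterlacingForm} {s : WaveState} {l m : ℝ}

theorem Interlaced.w_val_curv_le_gap (hs : s.Interlaced F) (hl : 0 ≤ l) :
    F.w s.val s.curv ≤ F.w (s.gap l).val (s.gap l).curv := by
  simp only [gap, map_add, map_smul, LinearMap.add_apply, LinearMap.smul_apply, smul_eq_mul,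
    F.w_self]
  have := mul_nonneg hl hs.w_slope_curv
  linarith

/-- The form `h` need not be symmetric, and nothing controls the sign of `h(curv, slope)`.
Completing the square absorbs that term together with half of `h(slope, curv)`. -/
theorem Interlaced.le_h_val_slope_gap (hs : s.Interlaced F) (hl : 0 ≤ l) :
    l * F.h (s.slope + (l / 2) • s.curv) (s.slope + (l / 2) • s.curv)
      + l ^ 3 / 4 * F.h s.curv s.curv ≤ F.h (s.gap l).val (s.gap l).slope := by
  simp only [gap, map_add, map_smul, LinearMap.add_apply, LinearMap.smul_apply, smul_eq_mul]
  have h1 := mul_nonneg hl hs.h_val_curv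
  have h2 := mul_nonneg (sq_nonneg l) hs.h_slope_curv
  have h3 := hs.h_val_slope
  linarith

theorem Interlaced.gap (hs : s.Interlaced F) (hl : 0 ≤ l) : (s.gap l).Interlaced F where
  w_val_slope := by
    have h1 := mul_nonneg hl hs.w_val_curv
    have h2 := mul_nonneg (sq_nonneg l) hs.w_slope_curv
    have h3 := hs.w_val_slope
    -- By antisymmetry the cross terms `l² w(slope, curv)` and `(l²/2) w(curv, slope)` combine to a
    -- nonnegative `(l²/2) w(slope, curv)`.
    have h4 := F.w_swap s.curv s.slope
    simp only [WaveState.gap, map_add, map_smul, LinearMap.add_apply, LinearMap.smul_apply,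
      smul_eq_mul, F.w_self, h4]
    linarith
  w_slope_curv := by
    simpa [WaveState.gap, F.w_self] using hs.w_slope_curv
  w_val_curv := hs.w_val_curv.trans (hs.w_val_curv_le_gap hl)
  h_val_slope := by
    refine le_trans ?_ (hs.le_h_val_slope_gap hl)
    have h1 := F.h_nonneg s.curv
    have h2 := F.h_nonneg (s.slope + (l / 2) • s.curv)
    positivity
  h_slope_curv := by
    simp only [WaveState.gap, map_add, map_smul, LinearMap.add_apply, LinearMap.smul_apply,
      smul_eq_mul]
    have h1 := mul_nonneg hl (F.h_nonneg s.curv)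
    linarith [hs.h_slope_curv]
  h_val_curv := by
    simp only [WaveState.gap, map_add, map_smul, LinearMap.add_apply, LinearMap.smul_apply,
      smul_eq_mul]
    have h1 := mul_nonneg hl hs.h_slope_curv
    have h2 := mul_nonneg (sq_nonneg l) (F.h_nonneg s.curv)
    linarith [hs.h_val_curv]

theorem w_val_curv_kick (F : InterlacingForm) (s : WaveState) (m : ℝ) :
    F.w (s.kick m).val (s.kick m).curv = F.w s.val s.curv + 2 * m * F.h s.val s.val := by
  simp only [kick, map_sub, map_smul, F.w_X, smul_eq_mul]
  ring

theorem w_slope_curv_kick (F : InterlacingForm) (s : WaveState) (m : ℝ) :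
    F.w (s.kick m).slope (s.kick m).curv = F.w s.slope s.curv + 2 * m * F.h s.val s.slope := by
  simp only [kick, map_sub, map_smul, F.w_X, smul_eq_mul]
  ring

/-- Subtracting `2m X val` from `curv` adds multiples of `h` to the `w`-inequalities and of `w` to
the `h`-inequalities, so neither family is preserved on its own. -/
theorem Interlaced.kick (hs : s.Interlaced F) (hm : 0 ≤ m) : (s.kick m).Interlaced F where
  w_val_slope := hs.w_val_slope
  w_slope_curv := by
    rw [w_slope_curv_kick]
    have h1 := mul_nonneg hm hs.h_val_slope
    linarith [hs.w_slope_curv]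
  w_val_curv := by
    rw [w_val_curv_kick]
    have h1 := mul_nonneg hm (F.h_nonneg s.val)
    linarith [hs.w_val_curv]
  h_val_slope := hs.h_val_slope
  h_slope_curv := by
    simp only [WaveState.kick, map_sub, map_smul, F.h_X, smul_eq_mul, F.w_swap s.slope s.val]
    have h1 := mul_nonneg (mul_nonneg hm F.nu_nonneg) hs.w_val_slope
    linarith [hs.h_slope_curv]
  h_val_curv := by
    simpa [WaveState.kick, F.h_X, F.w_self] using hs.h_val_curv

end WaveState

theorem interlaced_waveState (F : InterlacingForm) {x m : ℕ → ℝ} (hx : Monotone x)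
    (hm : ∀ k, 0 ≤ m k) (k : ℕ) : (waveState x m k).Interlaced F := by
  induction k with
  | zero =>
    refine WaveState.Interlaced.kick ?_ (hm 0)
    constructor <;> simp
  | succ k ih => exact (ih.gap (sub_nonneg.2 (hx k.le_succ))).kick (hm _)

/-- Strictness enters at the first mass through `h(1,1) > 0`; afterwards neither move decreases the
quantity. -/
theorem w_val_curv_waveState_pos (F : InterlacingForm) {x m : ℕ → ℝ} (hx : Monotone x)
    (hm : ∀ k, 0 < m k) (k : ℕ) : 0 < F.w (waveState x m k).val (waveState x m k).curv := by
  induction k with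
  | zero =>
    rw [waveState, WaveState.w_val_curv_kick]
    simpa using mul_pos (mul_pos two_pos (hm 0)) F.h_one
  | succ k ih =>
    rw [waveState, WaveState.w_val_curv_kick]
    have h1 := (interlaced_waveState F hx (fun k => (hm k).le) k).w_val_curv_le_gap
      (sub_nonneg.2 (hx k.le_succ))
    have h2 := mul_nonneg (hm (k + 1)).le
      (F.h_nonneg ((waveState x m k).gap (x (k + 1) - x k)).val)
    linarith

/-! ### The two concrete forms -/

/-- The form `Im (f(z) conj g(z))` for `z` in the upper half-plane. -/
noncomputable def halfPlaneForm (z : ℂ) (hz : 0 < z.im) : InterlacingForm where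
  w := LinearMap.mk₂ ℝ (fun f g => (aeval z f * starRingEnd ℂ (aeval z g)).im)
    (fun f f' g => by simp [add_mul]) (fun c f g => by simp; ring)
    (fun f g g' => by simp [mul_add]) (fun c f g => by simp; ring)
  h := LinearMap.mk₂ ℝ (fun f g => (z * aeval z f * starRingEnd ℂ (aeval z g)).im)
    (fun f f' g => by simp [mul_add, add_mul]) (fun c f g => by simp; ring)
    (fun f g g' => by simp [mul_add]) (fun c f g => by simp; ring)
  nu := Complex.normSq z
  nu_nonneg := Complex.normSq_nonneg z
  w_swap f g := by simp; ring
  h_nonneg f := by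
    simp only [LinearMap.mk₂_apply]
    rw [mul_assoc, Complex.mul_conj, Complex.im_mul_ofReal]
    exact mul_nonneg hz.le (Complex.normSq_nonneg _)
  h_one := by simpa using hz
  w_X f g := by simp; ring
  h_X f g := by simp [Complex.normSq_apply]; ring

/-- The Wronskian `f'(x) g(x) - f(x) g'(x)` at a real point, the limit of `halfPlaneForm`. -/
noncomputable def wronskianForm (x : ℝ) : InterlacingForm where
  w := LinearMap.mk₂ ℝ
    (fun f g => (derivative f).eval x * g.eval x - f.eval x * (derivative g).eval x)
    (fun f f' g => by simp; ring) (fun c f g => by simp; ring)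
    (fun f g g' => by simp; ring) (fun c f g => by simp; ring)
  -- The coefficient of `ε` in `Im (z f(z) conj g(z))` at `z = x + iε`; the factor `z` itself
  -- contributes `f g`.
  h := LinearMap.mk₂ ℝ (fun f g => f.eval x * g.eval x
      + x * ((derivative f).eval x * g.eval x - f.eval x * (derivative g).eval x))
    (fun f f' g => by simp; ring) (fun c f g => by simp; ring)
    (fun f g g' => by simp; ring) (fun c f g => by simp; ring)
  nu := x ^ 2
  nu_nonneg := sq_nonneg x
  w_swap f g := by simp; ring
  h_nonneg f := by
    simp only [LinearMap.mk₂_apply]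
    nlinarith [sq_nonneg (f.eval x)]
  h_one := by simp
  w_X f g := by simp; ring
  h_X f g := by simp; ring

theorem wronskianForm_w (x : ℝ) (f g : ℝ[X]) : (wronskianForm x).w f g =
    (derivative f).eval x * g.eval x - f.eval x * (derivative g).eval x := rfl

theorem wronskianForm_h_self (x : ℝ) (f : ℝ[X]) : (wronskianForm x).h f f = f.eval x ^ 2 := by
  simp only [wronskianForm, LinearMap.mk₂_apply]
  ring

/-! ### Zeros, degrees and signs of the string polynomials -/

section

variable {x m : ℕ → ℝ}

theorem aeval_curv_ne_zero_of_im_pos (hx : Monotone x) (hm : ∀ k, 0 < m k) (k : ℕ) {z : ℂ}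
    (hz : 0 < z.im) : aeval z (waveState x m k).curv ≠ 0 := by
  intro h
  have := w_val_curv_waveState_pos (halfPlaneForm z hz) hx hm k
  simp [halfPlaneForm, h] at this

theorem aeval_curv_ne_zero_of_im_ne_zero (hx : Monotone x) (hm : ∀ k, 0 < m k) (k : ℕ) {z : ℂ}
    (hz : z.im ≠ 0) : aeval z (waveState x m k).curv ≠ 0 := by
  rcases lt_or_gt_of_ne hz with h | h
  · intro h0
    refine aeval_curv_ne_zero_of_im_pos hx hm k (z := starRingEnd ℂ z) (by simpa using h) ?_
    rw [aeval_conj, h0, map_zero]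
  · exact aeval_curv_ne_zero_of_im_pos hx hm k h

theorem eval_derivative_curv_ne_zero (hx : Monotone x) (hm : ∀ k, 0 < m k) (k : ℕ) {y : ℝ}
    (hy : (waveState x m k).curv.eval y = 0) : (derivative (waveState x m k).curv).eval y ≠ 0 := by
  intro h
  have := w_val_curv_waveState_pos (wronskianForm y) hx hm k
  simp [wronskianForm_w, hy, h] at this

/-- The kick contributes a positive multiple of `h(val, slope)`, which is at least `l (slope + (l/2)
curv)² + (l³/4) curv²` at `y`, with `slope` and `curv` taken before the gap. This is positive unless
both vanish. -/
theorem wronskian_slope_curv_pos_of_ne_zero (hx : StrictMono x) (hm : ∀ k, 0 < m k) (k : ℕ) {y : ℝ}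
    (h : (waveState x m k).slope.eval y ≠ 0 ∨ (waveState x m k).curv.eval y ≠ 0) :
    0 < (wronskianForm y).w (waveState x m (k + 1)).slope (waveState x m (k + 1)).curv := by
  have hl : 0 < x (k + 1) - x k := sub_pos.2 (hx k.lt_succ_self)
  have hI := interlaced_waveState (wronskianForm y) hx.monotone (fun k => (hm k).le) k
  have h1 := hI.le_h_val_slope_gap hl.le
  have h2 := (hI.gap hl.le).w_slope_curv
  rw [waveState, WaveState.w_slope_curv_kick]
  refine add_pos_of_nonneg_of_pos h2 (mul_pos (by linarith [hm (k + 1)]) (lt_of_lt_of_le ?_ h1))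
  rw [wronskianForm_h_self, wronskianForm_h_self]
  by_cases hA : (waveState x m k).curv.eval y = 0
  · have hB : (waveState x m k).slope.eval y ≠ 0 := h.resolve_right (not_not.2 hA)
    simp only [eval_add, eval_smul, hA, smul_zero, add_zero]
    positivity
  · positivity

/-- A common zero would annihilate the Wronskian, which is positive by the previous lemma. The
induction starts from `curv = -2 m₀ y`, hence `y ≠ 0`. -/
theorem slope_ne_zero_or_curv_ne_zero (hx : StrictMono x) (hm : ∀ k, 0 < m k) (k : ℕ) {y : ℝ}
    (hy : y ≠ 0) : (waveState x m k).slope.eval y ≠ 0 ∨ (waveState x m k).curv.eval y ≠ 0 := by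
  induction k with
  | zero => right; simp [waveState, WaveState.kick, hy, (hm 0).ne']
  | succ k ih =>
    by_contra! h
    have := wronskian_slope_curv_pos_of_ne_zero hx hm k ih
    rw [wronskianForm_w, h.1, h.2] at this
    simp at this

theorem wronskian_slope_curv_pos (hx : StrictMono x) (hm : ∀ k, 0 < m k) (k : ℕ) {y : ℝ}
    (hy : y ≠ 0) : 0 < (derivative (waveState x m (k + 1)).slope).eval y
        * (waveState x m (k + 1)).curv.eval y
      - (waveState x m (k + 1)).slope.eval y
        * (derivative (waveState x m (k + 1)).curv).eval y :=
  wronskian_slope_curv_pos_of_ne_zero hx hm k (slope_ne_zero_or_curv_ne_zero hx hm k hy)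

/-- A gap gives `val` the degree of `curv` through the coefficient `l²/2`, and the kick raises the
degree of `curv` by one through `X * val`. -/
theorem natDegree_waveState (hx : StrictMono x) (hm : ∀ k, 0 < m k) (k : ℕ) :
    (waveState x m k).val.natDegree ≤ k ∧ (waveState x m k).slope.natDegree ≤ k ∧
      (waveState x m k).curv.natDegree = k + 1 := by
  have key : ∀ (s : WaveState) (n : ℕ) (a : ℝ), 0 < a → s.val.natDegree = n →
      s.curv.natDegree ≤ n → s.val ≠ 0 → (s.kick a).curv.natDegree = n + 1 := by
    intro s n a ha hv hc h0
    have h1 : ((2 * a) • (X * s.val)).natDegree = n + 1 := by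
      rw [natDegree_smul _ (by positivity), natDegree_X_mul h0, hv]
    rw [WaveState.kick, natDegree_sub_eq_right_of_natDegree_lt (by omega), h1]
  induction k with
  | zero => exact ⟨by simp [waveState, WaveState.kick], by simp [waveState, WaveState.kick],
      key _ 0 _ (hm 0) (by simp) (by simp) (by simp)⟩
  | succ k ih =>
    obtain ⟨h1, h2, h3⟩ := ih
    have hl : 0 < x (k + 1) - x k := sub_pos.2 (hx k.lt_succ_self)
    rw [waveState]
    set s := waveState x m k
    set l := x (k + 1) - x k
    have hv : (s.gap l).val.natDegree = k + 1 := by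
      have h4 : ((l ^ 2 / 2) • s.curv).natDegree = k + 1 := by
        rw [natDegree_smul _ (by positivity), h3]
      have h5 : (s.val + l • s.slope).natDegree ≤ k :=
        natDegree_add_le_of_degree_le h1 ((natDegree_smul_le _ _).trans h2)
      rw [WaveState.gap, natDegree_add_eq_right_of_natDegree_lt (by omega), h4]
    refine ⟨hv.le, ?_, key (s.gap l) _ _ (hm _) hv h3.le ?_⟩
    · exact natDegree_add_le_of_degree_le (by omega) ((natDegree_smul_le _ _).trans h3.le)
    · rintro h
      rw [h] at hv
      simp at hv

theorem eval_zero_waveState (k : ℕ) : (waveState x m k).slope.eval 0 = 0 ∧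
    (waveState x m k).curv.eval 0 = 0 := by
  induction k with
  | zero => simp [waveState, WaveState.kick]
  | succ k ih => simp [waveState, WaveState.kick, WaveState.gap, ih.1, ih.2]

/-- For `y < 0` the kick adds `-2 m y val > 0`, and a gap has nonnegative coefficients. This
excludes negative zeros of `A`. -/
theorem eval_waveState_of_neg (hx : Monotone x) (hm : ∀ k, 0 < m k) {y : ℝ} (hy : y < 0) (k : ℕ) :
    0 < (waveState x m k).val.eval y ∧ 0 ≤ (waveState x m k).slope.eval y ∧
      0 < (waveState x m k).curv.eval y := by
  have key : ∀ (s : WaveState) (a : ℝ), 0 < a → 0 < s.val.eval y → 0 ≤ s.curv.eval y →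
      0 < (s.kick a).curv.eval y := by
    intro s a ha h1 h2
    simp only [WaveState.kick, eval_sub, eval_smul, eval_mul, eval_X, smul_eq_mul]
    nlinarith [mul_pos (mul_pos ha h1) (neg_pos.2 hy)]
  induction k with
  | zero => exact ⟨by simp [waveState, WaveState.kick], by simp [waveState, WaveState.kick],
      key _ _ (hm 0) (by simp) (by simp)⟩
  | succ k ih =>
    obtain ⟨h1, h2, h3⟩ := ih
    have hl : 0 ≤ x (k + 1) - x k := sub_nonneg.2 (hx k.le_succ)
    have h4 : 0 < ((waveState x m k).gap (x (k + 1) - x k)).val.eval y := by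
      simp only [WaveState.gap, eval_add, eval_smul, smul_eq_mul]
      positivity
    refine ⟨h4, ?_, key _ _ (hm _) h4 h3.le⟩
    simp only [waveState, WaveState.kick, WaveState.gap, eval_add, eval_smul, smul_eq_mul]
    positivity

end

/-! ### From the wave function to the polynomial states -/

theorem eqOn_of_hasDerivAt_of_tendsto {f g : ℝ → ℂ} {f' : ℝ → ℂ} {a b : ℝ} {c : ℂ}
    (hf : ∀ s ∈ Set.Ioo a b, HasDerivAt f (f' s) s) (hg : ∀ s ∈ Set.Ioo a b, HasDerivAt g (f' s) s)
    (hfa : Filter.Tendsto f (nhdsWithin a (Set.Ioi a)) (nhds c))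
    (hga : Filter.Tendsto g (nhdsWithin a (Set.Ioi a)) (nhds c)) : Set.EqOn f g (Set.Ioo a b) := by
  intro s hs
  have hconst : ∀ r ∈ Set.Ioo a b, f r - g r = f s - g s := fun r hr =>
    isOpen_Ioo.is_const_of_deriv_eq_zero (f := fun r => f r - g r) (convex_Ioo a b).isPreconnected
      (fun w hw => ((hf w hw).sub (hg w hw)).differentiableAt.differentiableWithinAt)
      (fun w hw => by simpa using ((hf w hw).fun_sub (hg w hw)).deriv) hr hs
  refine sub_eq_zero.1 (tendsto_nhds_unique (tendsto_const_nhds.congr' ?_)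
    (by simpa using hfa.sub hga))
  filter_upwards [Ioo_mem_nhdsGT (hs.1.trans hs.2)] with r hr
  exact (hconst r hr).symm

/-- A function with vanishing third derivative on an interval is quadratic there. -/
theorem quadratic_of_iteratedDeriv_three_eq_zero {f : ℝ → ℂ} {a b : ℝ} {c : ℂ}
    (hf : ContDiff ℝ 1 f) (h3 : ∀ t ∈ Set.Ioo a b, ContDiffAt ℝ 3 f t)
    (h4 : ∀ t ∈ Set.Ioo a b, iteratedDeriv 3 f t = 0)
    (hl : Filter.Tendsto (iteratedDeriv 2 f) (nhdsWithin a (Set.Ioi a)) (nhds c)) :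
    Set.EqOn (iteratedDeriv 2 f) (fun _ => c) (Set.Ioo a b) ∧
    Set.EqOn (deriv f) (fun t => deriv f a + ((t - a : ℝ) : ℂ) * c) (Set.Ioo a b) ∧
    Set.EqOn f (fun t => f a + ((t - a : ℝ) : ℂ) * deriv f a + ((t - a : ℝ) : ℂ) ^ 2 / 2 * c)
      (Set.Ioo a b) := by
  have hlin : ∀ s, HasDerivAt (fun t : ℝ => ((t - a : ℝ) : ℂ)) 1 s := fun s => by
    simpa using ((hasDerivAt_id s).sub_const a).ofReal_comp
  have e2 : Set.EqOn (iteratedDeriv 2 f) (fun _ => c) (Set.Ioo a b) := by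
    refine eqOn_of_hasDerivAt_of_tendsto (f' := fun _ => 0) (c := c) (fun s hs => ?_)
      (fun s _ => hasDerivAt_const s c) hl tendsto_const_nhds
    have := (differentiableAt_iteratedDeriv_aux (h3 s hs) 2 (by norm_num)).hasDerivAt
    rwa [← iteratedDeriv_succ, h4 s hs] at this
  have e1 : Set.EqOn (deriv f) (fun t => deriv f a + ((t - a : ℝ) : ℂ) * c) (Set.Ioo a b) := by
    refine eqOn_of_hasDerivAt_of_tendsto (f' := fun _ => c) (c := deriv f a) (fun s hs => ?_)
      (fun s _ => by simpa using ((hlin s).mul_const c).const_add (deriv f a))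
      (hf.continuous_deriv le_rfl).continuousWithinAt ?_
    · have := (differentiableAt_iteratedDeriv_aux (h3 s hs) 1 (by norm_num)).hasDerivAt
      rwa [← iteratedDeriv_succ, e2 hs, iteratedDeriv_one] at this
    · have : Continuous fun t : ℝ => deriv f a + ((t - a : ℝ) : ℂ) * c := by fun_prop
      simpa using (this.continuousWithinAt (s := Set.Ioi a) (x := a)).tendsto
  refine ⟨e2, e1, eqOn_of_hasDerivAt_of_tendsto
    (f' := fun t => deriv f a + ((t - a : ℝ) : ℂ) * c) (c := f a) (fun s hs => ?_)
    (fun s _ => ?_) hf.continuous.continuousWithinAt ?_⟩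
  · have := (hf.differentiable one_ne_zero s).hasDerivAt
    rwa [e1 hs] at this
  · have := (((hlin s).mul_const (deriv f a)).const_add (f a)).add
      ((((hlin s).fun_pow 2).div_const 2).mul_const c)
    refine this.congr_deriv ?_
    norm_num
  · have : Continuous fun t : ℝ =>
        f a + ((t - a : ℝ) : ℂ) * deriv f a + ((t - a : ℝ) : ℂ) ^ 2 / 2 * c := by fun_prop
    simpa using (this.continuousWithinAt (s := Set.Ioi a) (x := a)).tendsto

/-- The wave function and its derivatives at the masses are the components of the wave state. -/
theorem IsWaveFunction.eq_aeval_waveState {N : ℕ} {x m : Fin (N + 1) → ℝ} {z : ℂ} {φ : ℝ → ℂ}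
    (hφ : IsWaveFunction x m z φ) {x' m' : ℕ → ℝ} (hx' : StrictMono x')
    (hxx' : ∀ k, x k = x' k) (hmm' : ∀ k, m k = m' k) (k : ℕ) (hk : k < N + 1) :
    φ (x' k) = aeval z (waveState x' m' k).val ∧
    deriv φ (x' k) = aeval z (waveState x' m' k).slope ∧
    Filter.Tendsto (iteratedDeriv 2 φ) (nhdsWithin (x' k) (Set.Ioi (x' k)))
      (nhds (aeval z (waveState x' m' k).curv)) := by
  -- The equation provides some one-sided limits `a`, `b`; uniqueness of limits identifies `a` with
  -- the curvature arriving from the left.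
  have hjump : ∀ (j : ℕ) (_ : j < N + 1) (s : WaveState), φ (x' j) = aeval z s.val →
      Filter.Tendsto (iteratedDeriv 2 φ) (nhdsWithin (x' j) (Set.Iio (x' j)))
        (nhds (aeval z s.curv)) →
      Filter.Tendsto (iteratedDeriv 2 φ) (nhdsWithin (x' j) (Set.Ioi (x' j)))
        (nhds (aeval z (s.kick (m' j)).curv)) := by
    intro j hj s hv hc
    obtain ⟨a, b, ha, hb, hab⟩ := hφ.jump ⟨j, hj⟩
    rw [hxx', hmm'] at hab
    rw [hxx'] at ha hb
    simp only at ha hb hab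
    have hac := tendsto_nhds_unique ha hc
    convert hb using 2
    rw [hac, hv] at hab
    simp [WaveState.kick]
    linear_combination -hab
  induction k with
  | zero =>
    have hleft : ∀ t < x' 0, φ t = 1 := fun t ht => hφ.eq_one_left t (by simpa [hxx'] using ht)
    have hloc : ∀ t < x' 0, φ =ᶠ[nhds t] fun _ => 1 := fun t ht => by
      filter_upwards [Iio_mem_nhds ht] with w hw using hleft w hw
    have h0 : φ (x' 0) = 1 := by
      refine tendsto_nhds_unique
        (hφ.contDiff_one.continuous.continuousWithinAt (s := Set.Iio (x' 0)) (x := x' 0))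
        (tendsto_const_nhds.congr' ?_)
      filter_upwards [self_mem_nhdsWithin] with r hr using (hleft r hr).symm
    have h1 : deriv φ (x' 0) = 0 := by
      refine tendsto_nhds_unique ((hφ.contDiff_one.continuous_deriv le_rfl).continuousWithinAt
        (s := Set.Iio (x' 0)) (x := x' 0)) (tendsto_const_nhds.congr' ?_)
      filter_upwards [self_mem_nhdsWithin] with r hr
      rw [(hloc r hr).deriv_eq, deriv_const]
    refine ⟨by simp [waveState, WaveState.kick, h0], by simp [waveState, WaveState.kick, h1],
      hjump 0 hk ⟨1, 0, 0⟩ (by simp [h0]) ?_⟩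
    rw [map_zero]
    refine tendsto_const_nhds.congr' ?_
    filter_upwards [self_mem_nhdsWithin] with r hr
    rw [(hloc r hr).iteratedDeriv_eq 2]
    simp [iteratedDeriv_const]
  | succ k ih =>
    obtain ⟨i0, i1, i2⟩ := ih (by omega)
    have hlt : x' k < x' (k + 1) := hx' k.lt_succ_self
    have hgap : ∀ t ∈ Set.Ioo (x' k) (x' (k + 1)), t ∉ Set.range x := by
      rintro t ⟨h1, h2⟩ ⟨j, rfl⟩
      rw [hxx'] at h1 h2
      have := hx'.lt_iff_lt.1 h1
      have := hx'.lt_iff_lt.1 h2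
      omega
    obtain ⟨e2, e1, e0⟩ := quadratic_of_iteratedDeriv_three_eq_zero hφ.contDiff_one
      (fun t ht => hφ.contDiffAt_three t (hgap t ht))
      (fun t ht => hφ.iteratedDeriv_three t (hgap t ht)) i2
    have hmem : Set.Ioo (x' k) (x' (k + 1)) ∈ nhdsWithin (x' (k + 1)) (Set.Iio (x' (k + 1))) :=
      Ioo_mem_nhdsLT hlt
    set s := waveState x' m' k
    have v0 : φ (x' (k + 1)) = aeval z (s.gap (x' (k + 1) - x' k)).val := by
      have hc : Continuous fun t : ℝ => φ (x' k) + ((t - x' k : ℝ) : ℂ) * deriv φ (x' k)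
          + ((t - x' k : ℝ) : ℂ) ^ 2 / 2 * aeval z s.curv := by fun_prop
      have := tendsto_nhds_unique (hφ.contDiff_one.continuous.continuousWithinAt
        (s := Set.Iio (x' (k + 1))) (x := x' (k + 1)))
        (hc.continuousWithinAt.tendsto.congr' (e0.symm.eventuallyEq_of_mem hmem))
      rw [this, i0, i1]
      simp [WaveState.gap]
    have v1 : deriv φ (x' (k + 1)) = aeval z (s.gap (x' (k + 1) - x' k)).slope := by
      have hc : Continuous fun t : ℝ =>
          deriv φ (x' k) + ((t - x' k : ℝ) : ℂ) * aeval z s.curv := by fun_prop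
      have := tendsto_nhds_unique ((hφ.contDiff_one.continuous_deriv le_rfl).continuousWithinAt
        (s := Set.Iio (x' (k + 1))) (x := x' (k + 1)))
        (hc.continuousWithinAt.tendsto.congr' (e1.symm.eventuallyEq_of_mem hmem))
      rw [this, i1]
      simp [WaveState.gap]
    exact ⟨v0, v1, hjump (k + 1) hk _ v0
      (tendsto_const_nhds.congr' (e2.symm.eventuallyEq_of_mem hmem))⟩

/-- Lets the recursion run over `ℕ` with no index bounds; the points added beyond the last mass do
not affect the states up to index `N`. -/
theorem exists_strictMono_extension {N : ℕ} {x : Fin (N + 1) → ℝ} (hx : StrictMono x) :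
    ∃ x' : ℕ → ℝ, StrictMono x' ∧ ∀ k, x k = x' k := by
  refine ⟨fun k => if h : k < N + 1 then x ⟨k, h⟩ else x (Fin.last N) + k,
    strictMono_nat_of_lt_succ fun k => ?_, fun k => by simp only [dif_pos k.isLt]⟩
  by_cases h : k + 1 < N + 1
  · rw [dif_pos h, dif_pos (k.lt_succ_self.trans h)]
    exact hx (Fin.mk_lt_mk.2 k.lt_succ_self)
  · rw [dif_neg h]
    by_cases h' : k < N + 1
    · rw [dif_pos h']
      have : x ⟨k, h'⟩ ≤ x (Fin.last N) := hx.monotone (Fin.le_last _)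
      push_cast
      linarith [(Nat.cast_nonneg k : (0 : ℝ) ≤ k)]
    · rw [dif_neg h']
      push_cast
      linarith

/-- `A` and `B` are real polynomials in the spectral parameter. -/
theorem exists_waveState_eq {N : ℕ} {x m : Fin (N + 1) → ℝ} (hx : StrictMono x)
    (hm : ∀ k, 0 < m k) : ∃ x' m' : ℕ → ℝ, StrictMono x' ∧ (∀ k, 0 < m' k) ∧
      (∀ z, stringA x m hx z = aeval z (waveState x' m' N).curv) ∧
      (∀ z, stringB x m hx z = aeval z (waveState x' m' N).slope) := by
  obtain ⟨x', hx', hxx'⟩ := exists_strictMono_extension hx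
  have key := fun z => (isWaveFunction_waveFunction x m hx z).eq_aeval_waveState
    (m' := fun k => if h : k < N + 1 then m ⟨k, h⟩ else 1) hx' hxx' (fun k => by rw [dif_pos k.isLt]) N
    N.lt_succ_self
  have hlast : x (Fin.last N) = x' N := by simpa using hxx' (Fin.last N)
  refine ⟨x', fun k => if h : k < N + 1 then m ⟨k, h⟩ else 1, hx', fun k => ?_, fun z => ?_,
    fun z => ?_⟩
  · beta_reduce
    split_ifs
    exacts [hm _, one_pos]
  · rw [stringA, hlast]
    exact rightLim_eq_of_tendsto (key z).2.2
  · rw [stringB, hlast, ← (key z).2.1]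
    exact ((isWaveFunction_waveFunction x m hx z).contDiff_one.continuous_deriv
      le_rfl).continuousWithinAt.rightLim_eq

/-! ### Real-rooted polynomials, partial fractions and root counting -/

/-- A real polynomial all of whose complex zeros are real and simple has as many real zeros as its
degree. -/
theorem splits_and_nodup_roots {p : ℝ[X]} (hreal : ∀ z : ℂ, z.im ≠ 0 → aeval z p ≠ 0)
    (hsimple : ∀ y, p.eval y = 0 → (derivative p).eval y ≠ 0) : p.Splits ∧ p.roots.Nodup := by
  constructor
  · refine Splits.of_splits_map (algebraMap ℝ ℂ) (IsAlgClosed.splits _) fun a ha => ?_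
    have h0 : aeval a p = 0 := by
      rw [← eval_map_algebraMap]
      exact isRoot_of_mem_roots ha
    have him : a.im = 0 := not_not.1 fun h => hreal a h h0
    exact ⟨a.re, Complex.ext (by simp) (by simp [him])⟩
  · rw [Multiset.nodup_iff_count_le_one]
    intro y
    rw [count_roots]
    by_contra! h
    obtain ⟨h1, h2⟩ := isRoot_iterate_derivative_of_lt_rootMultiplicity (n := 1) h,
      isRoot_iterate_derivative_of_lt_rootMultiplicity (n := 0) (one_pos.trans h)
    exact hsimple y h2 h1

/-- A real-rooted polynomial with simple nonnegative zeros, one of them `0`, is a multiple of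
`X` times a nodal polynomial. -/
theorem exists_eq_mul_nodal {p : ℝ[X]} {N : ℕ} (hdeg : p.natDegree = N + 1) (hs : p.Splits)
    (hnodup : p.roots.Nodup) (hneg : ∀ y < 0, p.eval y ≠ 0) (h0 : p.eval 0 = 0) :
    ∃ lam : Fin N → ℝ, StrictMono lam ∧ (∀ k, 0 < lam k) ∧
      p = C p.leadingCoeff * (X * Lagrange.nodal Finset.univ lam) := by
  have hp : p ≠ 0 := by rintro rfl; simp at hdeg
  have hmem : ∀ y, y ∈ p.roots.toFinset ↔ p.eval y = 0 := fun y => by simp [hp]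
  have hcard : (p.roots.toFinset.erase 0).card = N := by
    rw [Finset.card_erase_of_mem ((hmem 0).2 h0), Multiset.toFinset_card_of_nodup hnodup,
      ← hs.natDegree_eq_card_roots, hdeg, Nat.add_sub_cancel]
  refine ⟨(p.roots.toFinset.erase 0).orderEmbOfFin hcard, OrderEmbedding.strictMono _,
    fun k => ?_, ?_⟩
  · have hk := Finset.mem_erase.1 (Finset.orderEmbOfFin_mem _ hcard k)
    exact lt_of_le_of_ne (not_lt.1 fun h => hneg _ h ((hmem _).1 hk.2)) hk.1.symm
  · conv_lhs => rw [hs.eq_prod_roots]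
    congr 1
    have h1 : (p.roots.map (X - C ·)).prod = ∏ y ∈ p.roots.toFinset, (X - C y) := by
      rw [Finset.prod, Multiset.toFinset_val, Multiset.dedup_eq_self.2 hnodup]
    rw [h1, ← Finset.mul_prod_erase _ _ ((hmem 0).2 h0), Lagrange.nodal_eq, C_0, sub_zero]
    congr 1
    conv_lhs => rw [← Finset.map_orderEmbOfFin_univ _ hcard, Finset.prod_map]
    rfl

/-- Partial fraction decomposition of `q / (c z ∏ (z - lam k))`, where `q` vanishes at `0`. -/
theorem div_eq_sum_nodalWeight {N : ℕ} {lam : Fin N → ℝ} (hlam : Function.Injective lam)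
    {r : ℝ[X]} (hr : r.degree < N) (c : ℝ) {z : ℂ}
    (hz : aeval z (C c * (X * Lagrange.nodal Finset.univ lam)) ≠ 0) :
    aeval z (X * r) / aeval z (C c * (X * Lagrange.nodal Finset.univ lam)) =
      ∑ k, ((Lagrange.nodalWeight Finset.univ lam k * r.eval (lam k) / c : ℝ) : ℂ) /
        (z - (lam k : ℂ)) := by
  set v : Fin N → ℂ := fun k => (lam k : ℂ)
  have hv : Set.InjOn v (Finset.univ : Finset (Fin N)) := fun i _ j _ h =>
    hlam (Complex.ofReal_injective h)
  have hnodal : aeval z (Lagrange.nodal Finset.univ lam) =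
      (Lagrange.nodal Finset.univ v).eval z := by
    simp [Lagrange.nodal_eq, eval_prod, v]
  have hw : ∀ k, Lagrange.nodalWeight Finset.univ v k =
      ((Lagrange.nodalWeight Finset.univ lam k : ℝ) : ℂ) := fun k => by
    simp [Lagrange.nodalWeight, v]
  simp only [map_mul, aeval_X, aeval_C, Complex.coe_algebraMap, hnodal] at hz ⊢
  obtain ⟨hc, hz0, hn⟩ : (c : ℂ) ≠ 0 ∧ z ≠ 0 ∧ (Lagrange.nodal Finset.univ v).eval z ≠ 0 := by
    simpa [not_or] using hz
  have hne : ∀ i ∈ Finset.univ, z ≠ v i := fun i hi h => hn (by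
    rw [h, Lagrange.eval_nodal_at_node hi])
  -- Since `r` has degree below the number of nodes, it equals its Lagrange interpolant; the
  -- barycentric formula divided by the nodal polynomial is the partial fraction expansion.
  have hq := Lagrange.eval_interpolate_not_at_node (s := Finset.univ) (v := v)
    (fun i => (r.map (algebraMap ℝ ℂ)).eval (v i)) hne
  rw [← Lagrange.eq_interpolate hv (by simpa using hr), eval_map_algebraMap] at hq
  rw [hq, show z * ((Lagrange.nodal Finset.univ v).eval z * ∑ i, Lagrange.nodalWeight Finset.univ v i
      * (z - v i)⁻¹ * (r.map (algebraMap ℝ ℂ)).eval (v i)) / (c * (z * (Lagrange.nodal Finset.univ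
      v).eval z)) = (∑ i, Lagrange.nodalWeight Finset.univ v i
      * (z - v i)⁻¹ * (r.map (algebraMap ℝ ℂ)).eval (v i)) / c by field_simp, Finset.sum_div]
  refine Finset.sum_congr rfl fun k _ => ?_
  have he : (r.map (algebraMap ℝ ℂ)).eval (v k) = ((r.eval (lam k) : ℝ) : ℂ) := by
    simpa using eval_map_apply (p := r) (f := algebraMap ℝ ℂ) (lam k)
  rw [hw, he]
  push_cast
  ring

/-- Between two zeros of `p` there is a zero of `q`, if their Wronskian has no zeros. -/
theorem exists_root_of_wronskian_pos {p q : ℝ[X]} {a b : ℝ} (hab : a < b) (ha : p.eval a = 0)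
    (hb : p.eval b = 0) (hw : ∀ y ∈ Set.Icc a b,
      0 < (derivative q).eval y * p.eval y - q.eval y * (derivative p).eval y) :
    ∃ y ∈ Set.Ioo a b, q.eval y = 0 := by
  by_contra! h
  have hq : ∀ y ∈ Set.Icc a b, q.eval y ≠ 0 := by
    intro y hy h0
    by_cases hp : p.eval y = 0
    · have := hw y hy
      simp [hp, h0] at this
    · refine h y ⟨lt_of_le_of_ne hy.1 ?_, lt_of_le_of_ne hy.2 ?_⟩ h0
      · rintro rfl; exact hp ha
      · rintro rfl; exact hp hb
  -- Rolle's theorem for `p / q`: the numerator of its derivative is minus the Wronskian.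
  obtain ⟨y, hy, h0⟩ := exists_hasDerivAt_eq_zero hab
    (f := fun y => p.eval y / q.eval y) (f' := fun y =>
      ((derivative p).eval y * q.eval y - p.eval y * (derivative q).eval y) / q.eval y ^ 2)
    (p.continuous.continuousOn.div q.continuous.continuousOn hq) (by simp [ha, hb])
    (fun y hy => (p.hasDerivAt y).fun_div (q.hasDerivAt y) (hq y (Set.Ioo_subset_Icc_self hy)))
  have h1 := hw y (Set.Ioo_subset_Icc_self hy)
  have h2 := hq y (Set.Ioo_subset_Icc_self hy)
  rw [div_eq_zero_iff, or_iff_left (pow_ne_zero 2 h2)] at h0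
  linarith

/-- A nonzero polynomial of degree at most `n + 1` vanishing at `0` and at `n` distinct positive
reals has no other zeros. -/
theorem aeval_eq_zero_iff_of_natDegree_le {n : ℕ} {q : ℝ[X]} (hq : q ≠ 0)
    (hdeg : q.natDegree ≤ n + 1) (h0 : q.eval 0 = 0) {mu : Fin n → ℝ}
    (hinj : Function.Injective mu) (hpos : ∀ j, 0 < mu j) (hmu : ∀ j, q.eval (mu j) = 0) (z : ℂ) :
    aeval z q = 0 ↔ z = 0 ∨ ∃ j, z = (mu j : ℂ) := by
  have hcast : ∀ y : ℝ, q.eval y = 0 → aeval (y : ℂ) q = 0 := fun y hy => by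
    have := aeval_algebraMap_apply ℂ y q
    simpa [hy] using this
  constructor
  · intro hz
    by_contra! h
    classical
    have hcard : (insert z (insert 0 (Finset.univ.image fun j => (mu j : ℂ)))).card = n + 2 := by
      rw [Finset.card_insert_of_notMem, Finset.card_insert_of_notMem,
        Finset.card_image_of_injective (f := fun j => (mu j : ℂ)) _
          (Complex.ofReal_injective.comp hinj), Finset.card_univ,
        Fintype.card_fin]
      · simpa using fun j => (hpos j).ne'
      · simpa using ⟨h.1, fun j => (h.2 j).symm⟩
    have hroots : (insert z (insert 0 (Finset.univ.image fun j => (mu j : ℂ)))).val ⊆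
        (q.map (algebraMap ℝ ℂ)).roots := by
      intro w hw
      rw [Finset.mem_val] at hw
      simp only [Finset.mem_insert, Finset.mem_image, Finset.mem_univ, true_and] at hw
      rw [mem_roots (map_ne_zero hq), IsRoot, eval_map_algebraMap]
      rcases hw with rfl | rfl | ⟨j, rfl⟩
      · exact hz
      · simpa using hcast 0 h0
      · exact hcast _ (hmu j)
    have := card_le_degree_of_subset_roots hroots
    rw [hcard, natDegree_map] at this
    omega
  · rintro (rfl | ⟨j, rfl⟩)
    · simpa using hcast 0 h0
    · exact hcast _ (hmu j)

/-! ### The main theorem -/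

theorem mainTheorem4 (N : ℕ) (x m : Fin (N + 1) → ℝ) (hx : StrictMono x) (hm : ∀ k, 0 < m k) :
    ∃ lam b : Fin N → ℝ,
      -- the zeros of `A` are `0 < lam 0 < ⋯ < lam (N - 1)`
      StrictMono lam ∧ (∀ k, 0 < lam k) ∧
      (∀ z : ℂ, stringA x m hx z = 0 ↔ z = 0 ∨ ∃ k, z = (lam k : ℂ)) ∧
      -- partial fraction decomposition of the Weyl function, with residues `b k`
      (∀ z : ℂ, stringA x m hx z ≠ 0 →
        weylW x m hx z = ∑ k, (b k : ℂ) / (z - (lam k : ℂ))) ∧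
      -- the residues are negative
      (∀ k, b k < 0) ∧
      -- the zeros of `B` and of `A` interlace
      (1 ≤ N → ∃ mu : Fin (N - 1) → ℝ,
        (∀ z : ℂ, stringB x m hx z = 0 ↔ z = 0 ∨ ∃ j, z = (mu j : ℂ)) ∧
        ∀ j : Fin (N - 1),
          lam ⟨j, by have := j.isLt; omega⟩ < mu j ∧
          mu j < lam ⟨j + 1, by have := j.isLt; omega⟩) := by
  obtain ⟨x', m', hx', hm', hA, hB⟩ := exists_waveState_eq hx hm
  obtain ⟨-, hqdeg, hpdeg⟩ := natDegree_waveState hx' hm' N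
  obtain ⟨hq0, hp0⟩ := eval_zero_waveState (x := x') (m := m') N
  -- For a single mass `B` is identically zero, so `1 ≤ N` is needed; with `N = 0` there are no
  -- residues to consider.
  have hw : 1 ≤ N → ∀ y ≠ 0, 0 < (derivative (waveState x' m' N).slope).eval y
        * (waveState x' m' N).curv.eval y
      - (waveState x' m' N).slope.eval y * (derivative (waveState x' m' N).curv).eval y := by
    intro hN y hy
    obtain ⟨n, rfl⟩ := Nat.exists_eq_add_of_le' hN
    exact wronskian_slope_curv_pos hx' hm' n hy
  obtain ⟨hsplits, hnodup⟩ := splits_and_nodup_roots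
    (fun z hz => aeval_curv_ne_zero_of_im_ne_zero hx'.monotone hm' N hz)
    (fun y hy => eval_derivative_curv_ne_zero hx'.monotone hm' N hy)
  obtain ⟨lam, hmono, hpos, hp⟩ := exists_eq_mul_nodal hpdeg hsplits hnodup
    (fun y hy => (eval_waveState_of_neg hx'.monotone hm' hy N).2.2.ne') hp0
  set p := (waveState x' m' N).curv
  set q := (waveState x' m' N).slope
  have hc : p.leadingCoeff ≠ 0 := by
    rw [Ne, leadingCoeff_eq_zero]
    intro h
    simp [h] at hpdeg
  set c := p.leadingCoeff
  -- Cancelling the common zero at `0` leaves `W = r / (c ∏ (z - lam k))`, so there is no pole at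
  -- `0`.
  obtain ⟨r, hr⟩ : X ∣ q := by rwa [X_dvd_iff, coeff_zero_eq_eval_zero]
  have hrdeg : r.degree < N := by
    rcases eq_or_ne r 0 with rfl | h
    · simp
    · rw [hr, natDegree_X_mul h] at hqdeg
      rw [degree_eq_natDegree h]
      exact_mod_cast hqdeg
  have hplam : ∀ k, p.eval (lam k) = 0 := fun k => by
    rw [hp]
    simp [Lagrange.eval_nodal_at_node (Finset.mem_univ k)]
  refine ⟨lam, fun k => Lagrange.nodalWeight Finset.univ lam k * r.eval (lam k) / c, hmono, hpos,
    fun z => ?_, fun z hz => ?_, fun k => ?_, fun hN => ?_⟩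
  · rw [hA, hp]
    simp [hc, Lagrange.nodal_eq, Finset.prod_eq_zero_iff, sub_eq_zero]
  · rw [hA, hp] at hz
    rw [weylW, hA, hB, hp, hr]
    exact div_eq_sum_nodalWeight hmono.injective hrdeg c hz
  · have h1 := hw (by have := k.isLt; omega) (lam k) (hpos k).ne'
    have hd : (derivative p).eval (lam k) =
        c * (lam k * (derivative (Lagrange.nodal Finset.univ lam)).eval (lam k)) := by
      rw [hp]
      simp [Lagrange.eval_nodal_at_node (Finset.mem_univ k)]
    rw [hplam, hd, hr, mul_zero, zero_sub, eval_mul, eval_X] at h1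
    beta_reduce
    rw [Lagrange.nodalWeight_eq_eval_derivative_nodal (Finset.mem_univ k)]
    set d := (derivative (Lagrange.nodal Finset.univ lam)).eval (lam k)
    have hd0 : d ≠ 0 := by
      rintro h
      simp [h] at h1
    have hl := hpos k
    -- The residue is `B A' / A'^2` at `lam k`, where the Wronskian inequality `h1` says `-B A' >
    -- 0`.
    have : d⁻¹ * r.eval (lam k) / c =
        -(-(lam k * r.eval (lam k) * (c * (lam k * d)))) / (c * lam k * d) ^ 2 := by
      field_simp
    rw [this]
    exact div_neg_of_neg_of_pos (neg_neg_of_pos h1) (by positivity)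
  · have hmu : ∀ j : Fin (N - 1), ∃ y ∈ Set.Ioo (lam ⟨j, by have := j.isLt; omega⟩)
        (lam ⟨j + 1, by have := j.isLt; omega⟩), q.eval y = 0 := fun j =>
      exists_root_of_wronskian_pos (hmono (Fin.mk_lt_mk.2 (Nat.lt_succ_self _))) (hplam _)
        (hplam _) fun y hy => hw hN y ((hpos _).trans_le hy.1).ne'
    choose mu hmu hmuq using hmu
    have hmumono : StrictMono mu := fun i j hij =>
      ((hmu i).2.trans_le (hmono.monotone (Fin.mk_le_mk.2 hij))).trans (hmu j).1
    have hq : q ≠ 0 := by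
      intro h
      have := hw hN 1 one_ne_zero
      simp [h] at this
    refine ⟨mu, fun z => ?_, fun j => hmu j⟩
    rw [hB]
    -- The degree bound `N` equals `(N - 1) + 1`: the `N - 1` points `mu j` and `0` exhaust the
    -- zeros of `B`.
    exact aeval_eq_zero_iff_of_natDegree_le hq (by omega) hq0 hmumono.injective
      (fun j => (hpos _).trans (hmu j).1) hmuq z
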